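/- Let $K$ and $S$ be compact Hausdorff spaces, with $K$ nonempty. Let $C(K)$ and $C(S)$ be the complex Banach spaces of complex-valued continuous functions on $K$ and $S$, respectively, endowed with the supremum norm, and let $L(C(K),C(S))$ be the Banach space of bounded linear operators $C(K)\to C(S)$ with the operator norm. Let $$NA(C(K),C(S))=\{T\in L(C(K),C(S)) : \|Tf\|=\|T\| \text{ for some } f\in C(K) \text{ with } \|f\|=1\}$$ be the set of norm-attaining operators. Then $$\overline{NA(C(K),C(S))}=L(C(K),C(S)),$$ where the closure is taken in the operator norm. -/

import Mathlib

/-- A bounded linear operator attains its norm if `‖T x‖ = ‖T‖` for some unit vector `x`. -/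
def NormAttaining {𝕜 X Y : Type*} [NontriviallyNormedField 𝕜]
    [NormedAddCommGroup X] [NormedSpace 𝕜 X] [NormedAddCommGroup Y] [NormedSpace 𝕜 Y]
    (T : X →L[𝕜] Y) : Prop :=
  ∃ x : X, ‖x‖ = 1 ∧ ‖T x‖ = ‖T‖

/-!
Suppose `f₀` almost attains the norm of `T`, up to a relative error `κ * δ ^ 2`. Amplify `T` near a
point of `S` at which this happens, so that `f₀` becomes almost norming wherever the new operator
`R` is large, and choose `f₁` norming `R` up to a much smaller error. Wherever `f₁` is almost
norming so is the average of `f₀` and `f₁`; by uniform convexity of the values, the functional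
`f ↦ R f s` then has mass `O(κ)` on the set where `f₀` and `f₁` are more than `δ / 2` apart. This
mass can be discarded by perturbing `R` near a single point, and `f₁` can be moved towards `f₀` on
that set, which yields a function within `δ` of `f₀` that norms, up to an arbitrarily small error,
an operator within `O(κ)` of `T`. Iterating with summable `κ` and `δ` and passing to the limit gives
a norm attaining operator close to `T`.
-/

open Filter Topology
open RCLike (re re_le_norm)
open Set (Icc)

section Cutoffs

variable {X : Type*} [TopologicalSpace X]

/-- The pointwise projection of a real function onto `[0, 1]`, used to build cutoff functions. -/
def unitClamp (u : C(X, ℝ)) : C(X, ℝ) := 0 ⊔ 1 ⊓ u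

lemma unitClamp_mem_Icc (u : C(X, ℝ)) : unitClamp u ∈ Icc 0 1 :=
  ⟨le_sup_left, sup_le zero_le_one inf_le_left⟩

lemma unitClamp_apply_eq_one {u : C(X, ℝ)} {x : X} (hx : 1 ≤ u x) : unitClamp u x = 1 := by
  simp [unitClamp, hx]

lemma pos_of_unitClamp_apply_ne_zero {u : C(X, ℝ)} {x : X} (hx : unitClamp u x ≠ 0) :
    0 < u x := by
  by_contra! hu
  exact hx (by simp [unitClamp, hu])

lemma exists_bump_of_pos {u : C(X, ℝ)} {x : X} (hx : 0 < u x) :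
    ∃ h ∈ Icc (0 : C(X, ℝ)) 1, h x = 1 ∧ ∀ y, h y ≠ 0 → 0 < u y := by
  refine ⟨unitClamp ((u x)⁻¹ • u), unitClamp_mem_Icc _, unitClamp_apply_eq_one ?_, fun y hy => ?_⟩
  · simp [hx.ne']
  · exact pos_of_mul_pos_right (pos_of_unitClamp_apply_ne_zero hy) (inv_nonneg.2 hx.le)

variable {E : Type*} [SeminormedAddCommGroup E]

/-- The factor `min 1 (r / ‖g x‖)` by which the radial retraction onto the ball of radius `r` scales
`g x`. It is written so as to be continuous at the zeros of `g`. -/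
noncomputable def truncFactor (r : ℝ) (g : C(X, E)) : C(X, ℝ) where
  toFun x := (max 1 (‖g x‖ / r))⁻¹
  continuous_toFun := Continuous.inv₀ (by fun_prop) fun _ => (lt_max_of_lt_left one_pos).ne'

lemma truncFactor_mem_Icc (r : ℝ) (g : C(X, E)) : truncFactor r g ∈ Icc 0 1 :=
  ⟨fun _ => inv_nonneg.2 (zero_le_one.trans (le_max_left _ _)),
    fun _ => inv_le_one_of_one_le₀ (le_max_left _ _)⟩

lemma truncFactor_apply_eq_one {r : ℝ} (hr : 0 < r) {g : C(X, E)} {x : X} (hx : ‖g x‖ ≤ r) :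
    truncFactor r g x = 1 := by
  simp [truncFactor, max_eq_left ((div_le_one hr).2 hx)]

variable [CompactSpace X] [NormedSpace ℝ E]

lemma norm_truncFactor_smul_le {r : ℝ} (hr : 0 < r) (g : C(X, E)) : ‖truncFactor r g • g‖ ≤ r := by
  refine (ContinuousMap.norm_le _ hr.le).2 fun x => ?_
  have hpos : 0 < max 1 (‖g x‖ / r) := lt_max_of_lt_left one_pos
  calc ‖(max 1 (‖g x‖ / r))⁻¹ • g x‖ = (max 1 (‖g x‖ / r))⁻¹ * ‖g x‖ := by
        rw [norm_smul, Real.norm_of_nonneg (inv_nonneg.2 hpos.le)]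
    _ ≤ r := by
        rw [inv_mul_le_iff₀ hpos, ← div_le_iff₀ hr]
        exact le_max_right _ _

lemma norm_smul_add_one_sub_smul_le {φ : C(X, ℝ)} (hφ : φ ∈ Icc 0 1) {g k : C(X, E)} {r : ℝ}
    (hr : 0 ≤ r) (hg : ‖g‖ ≤ r) (hk : ‖k‖ ≤ r) : ‖φ • g + (1 - φ) • k‖ ≤ r := by
  refine (ContinuousMap.norm_le _ hr).2 fun x => mem_closedBall_zero_iff.1 ?_
  exact convex_closedBall (0 : E) r
    (mem_closedBall_zero_iff.2 ((g.norm_coe_le_norm x).trans hg))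
    (mem_closedBall_zero_iff.2 ((k.norm_coe_le_norm x).trans hk))
    (hφ.1 x) (sub_nonneg.2 (hφ.2 x)) (add_sub_cancel _ _)

/-- `f` is obtained from `f₁` by moving it towards `f₀` where the two are more than `δ` apart. -/
lemma exists_clip {f₀ f₁ : C(X, E)} (hf₀ : ‖f₀‖ ≤ 1) (hf₁ : ‖f₁‖ ≤ 1) {δ : ℝ} (hδ : 0 < δ) :
    ∃ φ ∈ Icc (0 : C(X, ℝ)) 1, ∃ f : C(X, E), (∀ x, φ x ≠ 0 → δ / 2 ≤ ‖f₀ x - f₁ x‖) ∧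
      ‖f‖ ≤ 1 ∧ ‖f - f₀‖ ≤ δ ∧ (1 - φ) • f = (1 - φ) • f₁ := by
  let u : C(X, ℝ) := ⟨fun x => 2 / δ * ‖f₀ x - f₁ x‖ - 1, by fun_prop⟩
  let c := truncFactor δ (f₁ - f₀)
  refine ⟨unitClamp u, unitClamp_mem_Icc u, c • f₁ + (1 - c) • f₀, fun x hx => ?_,
    norm_smul_add_one_sub_smul_le (truncFactor_mem_Icc _ _) zero_le_one hf₁ hf₀, ?_, ?_⟩
  · have hux : 0 < 2 / δ * ‖f₀ x - f₁ x‖ - 1 := pos_of_unitClamp_apply_ne_zero hx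
    field_simp at hux
    linarith
  · convert norm_truncFactor_smul_le hδ (f₁ - f₀) using 2
    module
  · ext x
    change (1 - unitClamp u x) • (c x • f₁ x + (1 - c x) • f₀ x) = (1 - unitClamp u x) • f₁ x
    rcases le_total ‖f₁ x - f₀ x‖ δ with hx | hx
    · simp [show c x = 1 from truncFactor_apply_eq_one hδ hx]
    · have hux : 1 ≤ 2 / δ * ‖f₀ x - f₁ x‖ - 1 := by
        rw [norm_sub_rev]
        field_simp
        linarith
      simp [unitClamp_apply_eq_one (u := u) hux]

end Cutoffs

section InnerProductSpace

variable {H : Type*} [NormedAddCommGroup H] [InnerProductSpace ℝ H]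

lemma norm_half_smul_add_le {a b : H} (ha : ‖a‖ ≤ 1) (hb : ‖b‖ ≤ 1) {δ : ℝ} (hδ : 0 ≤ δ)
    (hab : δ ≤ ‖a - b‖) : ‖(1 / 2 : ℝ) • (a + b)‖ ≤ 1 - δ ^ 2 / 8 := by
  have hδ2 : δ ≤ 2 := hab.trans ((norm_sub_le a b).trans (by linarith))
  refine le_of_sq_le_sq ?_ (by nlinarith)
  calc ‖(1 / 2 : ℝ) • (a + b)‖ ^ 2 = (‖a‖ ^ 2 + ‖b‖ ^ 2) / 2 - ‖a - b‖ ^ 2 / 4 := by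
        have := parallelogram_law_with_norm ℝ a b
        rw [norm_smul, Real.norm_of_nonneg (by norm_num)]
        linarith
    _ ≤ (1 ^ 2 + 1 ^ 2) / 2 - δ ^ 2 / 4 := by gcongr
    _ ≤ (1 - δ ^ 2 / 8) ^ 2 := by nlinarith [sq_nonneg (δ ^ 2)]

end InnerProductSpace

section Multiplication

variable {𝕜 K E : Type*} [RCLike 𝕜] [TopologicalSpace K] [CompactSpace K]
  [NormedAddCommGroup E] [NormedSpace 𝕜 E] [NormedSpace ℝ E] [IsScalarTower ℝ 𝕜 E]

/-- Multiplication by a real function, as an operator on the space `C(K, E)` of vector-valued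
functions. For a functional `L`, the norm of `L ∘L mulOp φ` is the mass that `L` puts on `φ`. -/
noncomputable def mulOp (φ : C(K, ℝ)) : C(K, E) →L[𝕜] C(K, E) :=
  LinearMap.mkContinuous
    { toFun := fun f => φ • f
      map_add' := smul_add φ
      map_smul' := fun c f => ContinuousMap.ext fun x => smul_comm (φ x) c (f x) }
    ‖φ‖ fun f => (ContinuousMap.norm_le _ (by positivity)).2 fun x =>
      (norm_smul_le _ _).trans (by gcongr <;> exact ContinuousMap.norm_coe_le_norm _ x)

@[simp]
lemma mulOp_apply (φ : C(K, ℝ)) (f : C(K, E)) : mulOp (𝕜 := 𝕜) φ f = φ • f := rfl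

lemma norm_apply_smul_add_norm_apply_one_sub_smul_le (L : C(K, E) →L[𝕜] 𝕜) {φ : C(K, ℝ)}
    (hφ : φ ∈ Icc 0 1) {g k : C(K, E)} (hg : ‖g‖ ≤ 1) (hk : ‖k‖ ≤ 1) :
    ‖L (φ • g)‖ + ‖L ((1 - φ) • k)‖ ≤ ‖L‖ := by
  obtain ⟨u, hu, hug⟩ := RCLike.exists_norm_eq_mul_self (L (φ • g))
  obtain ⟨v, hv, hvk⟩ := RCLike.exists_norm_eq_mul_self (L ((1 - φ) • k))
  have hmul : ∀ (ψ : C(K, ℝ)) (c : 𝕜) (f : C(K, E)), ψ • c • f = c • ψ • f := fun ψ c =>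
    map_smul (mulOp (𝕜 := 𝕜) ψ) c
  have hball := L.unit_le_opNorm (φ • u • g + (1 - φ) • v • k)
    (norm_smul_add_one_sub_smul_le hφ zero_le_one (by rwa [norm_smul, hu, one_mul])
      (by rwa [norm_smul, hv, one_mul]))
  rwa [hmul, hmul, map_add, L.map_smul, L.map_smul, smul_eq_mul, smul_eq_mul, ← hug, ← hvk,
    ← RCLike.ofReal_add, RCLike.norm_of_nonneg (by positivity)] at hball

lemma norm_comp_mulOp_le (L : C(K, E) →L[𝕜] 𝕜) {φ : C(K, ℝ)} (hφ : φ ∈ Icc 0 1) :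
    ‖L ∘L mulOp φ‖ ≤ ‖L‖ :=
  ContinuousLinearMap.opNorm_le_of_unit_norm (norm_nonneg _) fun g hg =>
    le_of_add_le_of_nonneg_left
      (norm_apply_smul_add_norm_apply_one_sub_smul_le L hφ hg.le (k := 0) (by simp))
      (norm_nonneg _)

lemma norm_comp_mulOp_add_norm_apply_one_sub_smul_le (L : C(K, E) →L[𝕜] 𝕜) {φ : C(K, ℝ)}
    (hφ : φ ∈ Icc 0 1) {k : C(K, E)} (hk : ‖k‖ ≤ 1) :
    ‖L ∘L mulOp φ‖ + ‖L ((1 - φ) • k)‖ ≤ ‖L‖ := by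
  have hbound : ∀ g : C(K, E), ‖g‖ ≤ 1 → ‖L (φ • g)‖ ≤ ‖L‖ - ‖L ((1 - φ) • k)‖ := fun g hg =>
    le_sub_iff_add_le.2 (norm_apply_smul_add_norm_apply_one_sub_smul_le L hφ hg hk)
  refine le_sub_iff_add_le.1 (ContinuousLinearMap.opNorm_le_of_unit_norm ?_ fun g hg =>
    hbound g hg.le)
  exact (norm_nonneg _).trans (hbound 0 (by simp))

lemma norm_comp_mulOp_le_re_add (L : C(K, E) →L[𝕜] 𝕜) {φ : C(K, ℝ)} (hφ : φ ∈ Icc 0 1)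
    {f : C(K, E)} (hf : ‖f‖ ≤ 1) {ε : ℝ} (hLf : ‖L‖ ≤ re (L f) + ε) :
    ‖L ∘L mulOp φ‖ ≤ re (L (φ • f)) + ε := by
  have hsplit : re (L f) = re (L (φ • f)) + re (L ((1 - φ) • f)) := by
    rw [← map_add, ← map_add, ← add_smul, add_sub_cancel, one_smul]
  linarith [norm_comp_mulOp_add_norm_apply_one_sub_smul_le L hφ hf, re_le_norm (L ((1 - φ) • f))]

lemma one_sub_mul_norm_comp_mulOp_le (L : C(K, E) →L[𝕜] 𝕜) {φ : C(K, ℝ)} (hφ : φ ∈ Icc 0 1)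
    {f : C(K, E)} (hf : ‖f‖ ≤ 1) {ε r : ℝ} (hLf : ‖L‖ ≤ re (L f) + ε) (hr : 0 < r)
    (hfr : ∀ x, φ x ≠ 0 → ‖f x‖ ≤ r) : (1 - r) * ‖L ∘L mulOp φ‖ ≤ ε := by
  have htrunc : φ • f = φ • truncFactor r f • f := by
    ext x
    by_cases hx : φ x = 0
    · simp [hx]
    · simp [truncFactor_apply_eq_one hr (hfr x hx)]
  have hre : re (L (φ • f)) ≤ ‖L ∘L mulOp φ‖ * r := by
    rw [htrunc]
    exact (re_le_norm _).trans
      ((L ∘L mulOp φ).le_opNorm_of_le (norm_truncFactor_smul_le hr f))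
  linarith [norm_comp_mulOp_le_re_add L hφ hf hLf]

end Multiplication

section HilbertValued

variable {𝕜 K H : Type*} [RCLike 𝕜] [TopologicalSpace K] [CompactSpace K]
  [NormedAddCommGroup H] [NormedSpace 𝕜 H] [InnerProductSpace ℝ H] [IsScalarTower ℝ 𝕜 H]

/-- The midpoint of `f₀` and `f₁` is still almost norming, but by uniform convexity it is small
where `f₀` and `f₁` are far apart. -/
lemma norm_comp_mulOp_le_of_separated (L : C(K, H) →L[𝕜] 𝕜) {φ : C(K, ℝ)} (hφ : φ ∈ Icc 0 1)
    {f₀ f₁ : C(K, H)} (hf₀ : ‖f₀‖ ≤ 1) (hf₁ : ‖f₁‖ ≤ 1) {κ δ : ℝ} (hδ : 0 < δ) (hδ2 : δ ≤ 2)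
    (hL₀ : (1 - κ * δ ^ 2) * ‖L‖ ≤ re (L f₀)) (hL₁ : (1 - κ * δ ^ 2) * ‖L‖ ≤ re (L f₁))
    (hsep : ∀ x, φ x ≠ 0 → δ ≤ ‖f₀ x - f₁ x‖) : ‖L ∘L mulOp φ‖ ≤ 8 * κ * ‖L‖ := by
  let m : C(K, H) := (1 / 2 : ℝ) • (f₀ + f₁)
  have hm : ‖m‖ ≤ 1 := by
    rw [norm_smul, Real.norm_of_nonneg (by norm_num)]
    linarith [norm_add_le f₀ f₁]
  have hLm : re (L m) = (re (L f₀) + re (L f₁)) / 2 := by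
    rw [L.map_smul_of_tower, map_add, RCLike.smul_re, map_add]
    ring
  have hmass := one_sub_mul_norm_comp_mulOp_le L hφ hm (ε := κ * δ ^ 2 * ‖L‖) (r := 1 - δ ^ 2 / 8)
    (by linarith) (by nlinarith) fun x hx => norm_half_smul_add_le
      ((f₀.norm_coe_le_norm x).trans hf₀) ((f₁.norm_coe_le_norm x).trans hf₁) hδ.le (hsep x hx)
  refine le_of_mul_le_mul_left ?_ (show 0 < δ ^ 2 / 8 by positivity)
  linarith

end HilbertValued

section Blending

variable {𝕜 X S : Type*} [RCLike 𝕜] [NormedAddCommGroup X] [NormedSpace 𝕜 X]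
  [TopologicalSpace S]

/-- The functional `x ↦ T x s`, that is, the image of the point mass at `s` under the adjoint of an
operator `T` into `C(S, 𝕜)`. -/
noncomputable def pointFunctional (T : X →L[𝕜] C(S, 𝕜)) (s : S) : X →L[𝕜] 𝕜 :=
  ContinuousMap.evalCLM 𝕜 s ∘L T

@[simp]
lemma pointFunctional_apply (T : X →L[𝕜] C(S, 𝕜)) (s : S) (x : X) :
    pointFunctional T s x = T x s := rfl

lemma re_apply_le_norm_pointFunctional (T : X →L[𝕜] C(S, 𝕜)) (s : S) {x : X} (hx : ‖x‖ ≤ 1) :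
    re (T x s) ≤ ‖pointFunctional T s‖ :=
  (re_le_norm _).trans ((pointFunctional T s).unit_le_opNorm x hx)

variable [CompactSpace S]

lemma norm_pointFunctional_le (T : X →L[𝕜] C(S, 𝕜)) (s : S) : ‖pointFunctional T s‖ ≤ ‖T‖ :=
  ContinuousLinearMap.opNorm_le_bound _ (norm_nonneg _) fun x =>
    ((T x).norm_coe_le_norm s).trans (T.le_opNorm x)

lemma norm_le_of_forall_norm_pointFunctional_le {T : X →L[𝕜] C(S, 𝕜)} {C : ℝ} (hC : 0 ≤ C)
    (hT : ∀ s, ‖pointFunctional T s‖ ≤ C) : ‖T‖ ≤ C :=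
  T.opNorm_le_bound hC fun x => (ContinuousMap.norm_le _ (by positivity)).2 fun s =>
    (pointFunctional T s).le_of_opNorm_le (hT s) x

/-- The operator equal to `(1 - h s) T + h s P` over the point `s`. It modifies `T` near a point
of `S` only. -/
noncomputable def blend (h : C(S, ℝ)) (T P : X →L[𝕜] C(S, 𝕜)) : X →L[𝕜] C(S, 𝕜) :=
  T + mulOp h ∘L (P - T)

lemma blend_apply (h : C(S, ℝ)) (T P : X →L[𝕜] C(S, 𝕜)) (x : X) (s : S) :
    blend h T P x s = (1 - h s) • T x s + h s • P x s := by
  change T x s + h s • (P x s - T x s) = _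
  module

lemma pointFunctional_blend (h : C(S, ℝ)) (T P : X →L[𝕜] C(S, 𝕜)) (s : S) :
    pointFunctional (blend h T P) s =
      (1 - h s) • pointFunctional T s + h s • pointFunctional P s :=
  ContinuousLinearMap.ext fun x => blend_apply h T P x s

lemma norm_blend_le {h : C(S, ℝ)} (hh : h ∈ Icc 0 1) {T P : X →L[𝕜] C(S, 𝕜)} {C : ℝ}
    (hT : ‖T‖ ≤ C) (hP : ∀ s, h s ≠ 0 → ‖pointFunctional P s‖ ≤ C) : ‖blend h T P‖ ≤ C := by
  refine norm_le_of_forall_norm_pointFunctional_le ((norm_nonneg T).trans hT) fun s => ?_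
  have hTs := (norm_pointFunctional_le T s).trans hT
  rw [pointFunctional_blend]
  rcases eq_or_ne (h s) 0 with hs | hs
  · refine (congrArg norm (ContinuousLinearMap.ext fun x => ?_)).trans_le hTs
    simp [hs]
  · exact mem_closedBall_zero_iff.1 (convex_closedBall (0 : X →L[𝕜] 𝕜) C
      (mem_closedBall_zero_iff.2 hTs) (mem_closedBall_zero_iff.2 (hP s hs))
      (sub_nonneg.2 (hh.2 s)) (hh.1 s) (sub_add_cancel _ _))

lemma norm_blend_sub_le {h : C(S, ℝ)} (hh : h ∈ Icc 0 1) {T P : X →L[𝕜] C(S, 𝕜)} {C : ℝ}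
    (hC : 0 ≤ C) (hP : ∀ s, h s ≠ 0 → ‖pointFunctional P s - pointFunctional T s‖ ≤ C) :
    ‖blend h T P - T‖ ≤ C := by
  refine norm_le_of_forall_norm_pointFunctional_le hC fun s => ?_
  have hsub : pointFunctional (blend h T P - T) s =
      h s • (pointFunctional P s - pointFunctional T s) := by
    rw [blend, add_sub_cancel_left]
    rfl
  have hhs : 0 ≤ h s := hh.1 s
  rw [hsub, norm_smul, Real.norm_of_nonneg hhs]
  rcases eq_or_ne (h s) 0 with hs | hs
  · simpa [hs] using hC
  · exact (mul_le_of_le_one_left (norm_nonneg _) (hh.2 s)).trans (hP s hs)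

lemma pointFunctional_blend_one_add_smul (h : C(S, ℝ)) (T : X →L[𝕜] C(S, 𝕜)) (c : ℝ) (s : S) :
    pointFunctional (blend h T ((1 + c) • T)) s = (1 + c * h s) • pointFunctional T s := by
  have hsmul : pointFunctional ((1 + c) • T) s = (1 + c) • pointFunctional T s := rfl
  rw [pointFunctional_blend, hsmul]
  module

lemma norm_blend_one_add_smul_sub_le {h : C(S, ℝ)} (hh : h ∈ Icc 0 1) (T : X →L[𝕜] C(S, 𝕜))
    {c : ℝ} (hc : 0 ≤ c) : ‖blend h T ((1 + c) • T) - T‖ ≤ c * ‖T‖ := by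
  refine norm_blend_sub_le hh (by positivity) fun s _ => ?_
  have hsub : pointFunctional ((1 + c) • T) s - pointFunctional T s = c • pointFunctional T s := by
    have hsmul : pointFunctional ((1 + c) • T) s = (1 + c) • pointFunctional T s := rfl
    rw [hsmul]
    module
  rw [hsub, norm_smul, Real.norm_of_nonneg hc]
  gcongr
  exact norm_pointFunctional_le T s

lemma le_one_sub_half_mul_of_one_add_mul_le {a b η : ℝ} (hη : 0 ≤ η) (hη1 : η ≤ 1) (ha : 0 ≤ a)
    (hab : (1 + η) * a ≤ b) : a ≤ (1 - η / 2) * b :=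
  calc a ≤ (1 - η / 2) * (1 + η) * a := le_mul_of_one_le_left ha (by nlinarith)
    _ ≤ (1 - η / 2) * b := by
        rw [mul_assoc]
        gcongr
        linarith

/-- `R` is `T` amplified near `s₀`, so that its norm is not approached at the points where `x` fails
to be almost norming. -/
lemma exists_boost {T : X →L[𝕜] C(S, 𝕜)} (hT : 0 < ‖T‖) {x : X} (hx : ‖x‖ ≤ 1) {s₀ : S} {η : ℝ}
    (hη : 0 < η) (hη3 : η ≤ 1 / 3) (hs₀ : (1 - η) * ‖T‖ ≤ re (T x s₀)) :
    ∃ R : X →L[𝕜] C(S, 𝕜), ‖R - T‖ ≤ 3 * η * ‖T‖ ∧ ‖T‖ ≤ ‖R‖ ∧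
      ∀ s, (1 - η / 2) * ‖R‖ < ‖pointFunctional R s‖ →
        (1 - 2 * η) * ‖pointFunctional R s‖ ≤ re (R x s) := by
  let u : C(S, ℝ) := ⟨fun s => re (T x s) - (1 - 2 * η) * ‖T‖, by fun_prop⟩
  obtain ⟨h, hh, hhs₀, hhu⟩ := exists_bump_of_pos (u := u) (x := s₀)
    (show 0 < re (T x s₀) - (1 - 2 * η) * ‖T‖ by nlinarith)
  let R := blend h T ((1 + 3 * η) • T)
  have hRs : ∀ s, pointFunctional R s = (1 + 3 * η * h s) • pointFunctional T s :=
    pointFunctional_blend_one_add_smul h T (3 * η)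
  have hRx : ∀ s, re (R x s) = (1 + 3 * η * h s) * re (T x s) := fun s => by
    rw [← pointFunctional_apply, hRs, ← RCLike.smul_re]
    rfl
  have hTR : (1 + η) * ‖T‖ ≤ ‖R‖ :=
    calc (1 + η) * ‖T‖ ≤ (1 + 3 * η) * ((1 - η) * ‖T‖) := by
          rw [← mul_assoc]
          gcongr
          nlinarith
      _ ≤ (1 + 3 * η) * re (T x s₀) := by gcongr
      _ = re (R x s₀) := by rw [hRx, hhs₀, mul_one]
      _ ≤ ‖R‖ := (re_apply_le_norm_pointFunctional R s₀ hx).trans (norm_pointFunctional_le R s₀)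
  refine ⟨R, norm_blend_one_add_smul_sub_le hh T (by positivity),
    (le_mul_of_one_le_left hT.le (by linarith)).trans hTR, fun s hs => ?_⟩
  have hhs : h s ≠ 0 := fun h0 => by
    rw [hRs, h0, mul_zero, add_zero, one_smul] at hs
    exact hs.not_ge ((norm_pointFunctional_le T s).trans
      (le_one_sub_half_mul_of_one_add_mul_le hη.le (by linarith) hT.le hTR))
  have hu : 0 < re (T x s) - (1 - 2 * η) * ‖T‖ := hhu s hhs
  have hpos : 0 ≤ 1 + 3 * η * h s := by
    have : 0 ≤ h s := hh.1 s
    positivity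
  calc (1 - 2 * η) * ‖pointFunctional R s‖
      = (1 + 3 * η * h s) * ((1 - 2 * η) * ‖pointFunctional T s‖) := by
        rw [hRs, norm_smul, Real.norm_of_nonneg hpos]
        ring
    _ ≤ (1 + 3 * η * h s) * re (T x s) := by
        gcongr
        nlinarith [norm_pointFunctional_le T s]
    _ = re (R x s) := (hRx s).symm

lemma re_sub_le_re_apply {L M : X →L[𝕜] 𝕜} {x : X} (hx : ‖x‖ ≤ 1) {ε : ℝ} (hLM : ‖M - L‖ ≤ ε) :
    re (L x) - ε ≤ re (M x) := by
  have hdiff : re ((L - M) x) ≤ ε := (re_le_norm _).trans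
    (((L - M).unit_le_opNorm x hx).trans ((norm_sub_rev L M).trans_le hLM))
  rw [_root_.sub_apply, map_sub] at hdiff
  linarith

lemma norm_smul_sub_le {F : Type*} [SeminormedAddCommGroup F] [NormedSpace ℝ F] {l : ℝ}
    (hl : 1 ≤ l) (a b : F) : ‖l • a - b‖ ≤ (l - 1) * ‖a‖ + ‖a - b‖ :=
  calc ‖l • a - b‖ = ‖(l - 1) • a + (a - b)‖ := by congr 1; module
    _ ≤ (l - 1) * ‖a‖ + ‖a - b‖ := (norm_add_le _ _).trans_eq (by
      rw [norm_smul, Real.norm_of_nonneg (sub_nonneg.2 hl)])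

lemma exists_mul_eq_of_le {A m σ : ℝ} (hA : 0 < A) (hσ : σ ≤ 1 / 2) (hm : (1 - σ) * A ≤ m)
    (hmA : m ≤ A) : ∃ l, l * m = A ∧ 1 ≤ l ∧ l ≤ 1 + 2 * σ := by
  have hm0 : 0 < m := by nlinarith
  refine ⟨A / m, div_mul_cancel₀ _ hm0.ne', (one_le_div hm0).2 hmA, (div_le_iff₀ hm0).2 ?_⟩
  nlinarith

/-- Near a point `s₁` at which `x` almost norms `T`, the operator is blended with a multiple `l • N`
of an approximation `N`, the factor `l` making up for the loss of norm in passing from `T` to `N`.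
The increase of the norm is controlled by `η` alone and not by the possibly much larger `τ`. -/
lemma exists_transfer {T N : X →L[𝕜] C(S, 𝕜)} (hT : 0 < ‖T‖) (hNT : ‖N‖ ≤ ‖T‖) {x : X}
    (hx : ‖x‖ ≤ 1) {s₁ : S} {η τ : ℝ} (hη : 0 < η) (hητ : η + τ ≤ 1 / 2)
    (hs₁ : (1 - η) * ‖T‖ ≤ re (T x s₁))
    (hclose : ∀ s, (1 - 2 * η) * ‖T‖ < re (T x s) →
      ‖pointFunctional N s - pointFunctional T s‖ ≤ τ * ‖T‖)
    (hnorming : ∀ s, (1 - 2 * η) * ‖T‖ < re (T x s) →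
      ‖pointFunctional N s‖ ≤ re (N x s) + 2 * η * ‖T‖) :
    ∃ Q : X →L[𝕜] C(S, 𝕜), ‖Q‖ ≤ (1 + 6 * η) * ‖T‖ ∧ ‖Q - T‖ ≤ (3 * τ + 2 * η) * ‖T‖ ∧
      ∀ y, N y s₁ = N x s₁ → re (Q y s₁) = ‖T‖ := by
  have hs₁' : (1 - 2 * η) * ‖T‖ < re (T x s₁) := by nlinarith
  have hN : ∀ s, ‖pointFunctional N s‖ ≤ ‖T‖ := fun s => (norm_pointFunctional_le N s).trans hNT
  set m := re (N x s₁) with hm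
  have hm_ge : re (T x s₁) - τ * ‖T‖ ≤ m := re_sub_le_re_apply hx (hclose s₁ hs₁')
  obtain ⟨l, hlm, hl1, hl⟩ := exists_mul_eq_of_le hT hητ (by linarith)
    ((re_apply_le_norm_pointFunctional N s₁ hx).trans (hN s₁))
  let u : C(S, ℝ) :=
    ⟨fun s => min (re (T x s) - (1 - 2 * η) * ‖T‖) (m + η * ‖T‖ - re (N x s)), by fun_prop⟩
  obtain ⟨h, hh, hhs₁, hhu⟩ := exists_bump_of_pos (u := u) (x := s₁)
    (lt_min (sub_pos.2 hs₁') (sub_pos.2 (lt_add_of_pos_right m (by positivity))))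
  have hsupp : ∀ s, h s ≠ 0 → (1 - 2 * η) * ‖T‖ < re (T x s) ∧ re (N x s) < m + η * ‖T‖ :=
    fun s hs => (lt_min_iff.1 (hhu s hs)).imp sub_pos.1 sub_pos.1
  have hlN : ∀ s, pointFunctional (l • N) s = l • pointFunctional N s := fun s => rfl
  have hητ0 : 0 ≤ τ * ‖T‖ := (norm_nonneg _).trans (hclose s₁ hs₁')
  refine ⟨blend h T (l • N), norm_blend_le hh (by nlinarith) fun s hs => ?_,
    norm_blend_sub_le hh (by nlinarith) fun s hs => ?_, fun y hy => ?_⟩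
  · obtain ⟨hTs, hNs⟩ := hsupp s hs
    rw [hlN, norm_smul, Real.norm_of_nonneg (by linarith)]
    calc l * ‖pointFunctional N s‖ ≤ l * (m + 3 * η * ‖T‖) := by
          gcongr
          linarith [hnorming s hTs]
      _ = ‖T‖ + l * (3 * η * ‖T‖) := by rw [mul_add, hlm]
      _ ≤ ‖T‖ + 2 * (3 * η * ‖T‖) := by
          gcongr
          linarith
      _ = (1 + 6 * η) * ‖T‖ := by ring
  · calc ‖pointFunctional (l • N) s - pointFunctional T s‖
        ≤ (l - 1) * ‖pointFunctional N s‖ + ‖pointFunctional N s - pointFunctional T s‖ := by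
          rw [hlN]
          exact norm_smul_sub_le hl1 _ _
      _ ≤ (2 * (η + τ)) * ‖T‖ + τ * ‖T‖ := by
          gcongr
          · linarith
          · linarith
          · exact hN s
          · exact hclose s (hsupp s hs).1
      _ = (3 * τ + 2 * η) * ‖T‖ := by ring
  · rw [blend_apply, hhs₁, sub_self, zero_smul, zero_add, one_smul]
    change re (l • N y s₁) = ‖T‖
    rw [hy, RCLike.smul_re, ← hm, hlm]

end Blending

section Cut

variable {𝕜 K S E : Type*} [RCLike 𝕜] [TopologicalSpace K] [CompactSpace K]
  [TopologicalSpace S] [CompactSpace S]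
  [NormedAddCommGroup E] [NormedSpace 𝕜 E] [NormedSpace ℝ E] [IsScalarTower ℝ 𝕜 E]

lemma exists_cut {T : C(K, E) →L[𝕜] C(S, 𝕜)} (hT : 0 < ‖T‖) {f₁ : C(K, E)} (hf₁ : ‖f₁‖ ≤ 1)
    {s₁ : S} {η τ : ℝ} (hη : 0 < η) (hητ : η + τ ≤ 1 / 2) (hs₁ : (1 - η) * ‖T‖ ≤ re (T f₁ s₁))
    {φ : C(K, ℝ)} (hφ : φ ∈ Icc 0 1)
    (hτ : ∀ s, (1 - 2 * η) * ‖T‖ < re (T f₁ s) → ‖pointFunctional T s ∘L mulOp φ‖ ≤ τ * ‖T‖) :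
    ∃ Q : C(K, E) →L[𝕜] C(S, 𝕜), ‖Q‖ ≤ (1 + 6 * η) * ‖T‖ ∧ ‖Q - T‖ ≤ (3 * τ + 2 * η) * ‖T‖ ∧
      ∀ f : C(K, E), (1 - φ) • f = (1 - φ) • f₁ → re (Q f s₁) = ‖T‖ := by
  have hφ' : 1 - φ ∈ Icc 0 1 := Set.Icc.mem_iff_one_sub_mem.1 hφ
  have hsub : ∀ s, pointFunctional (T ∘L mulOp (1 - φ)) s - pointFunctional T s =
      -(pointFunctional T s ∘L mulOp φ) := fun s => by
    ext f
    change T ((1 - φ) • f) s - T f s = -T (φ • f) s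
    rw [sub_smul, one_smul, map_sub, ContinuousMap.sub_apply, sub_sub_cancel_left]
  obtain ⟨Q, hQ, hQT, hQs₁⟩ := exists_transfer (N := T ∘L mulOp (1 - φ)) hT
    (norm_le_of_forall_norm_pointFunctional_le (norm_nonneg T) fun s =>
      (norm_comp_mulOp_le (pointFunctional T s) hφ').trans (norm_pointFunctional_le T s))
    hf₁ hη hητ hs₁ (fun s hs => by simpa only [hsub, norm_neg] using hτ s hs) fun s hs =>
      norm_comp_mulOp_le_re_add (pointFunctional T s) hφ' hf₁ (by
        rw [pointFunctional_apply]
        linarith [norm_pointFunctional_le T s])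
  exact ⟨Q, hQ, hQT, fun f hf => hQs₁ f (by simp [hf])⟩

end Cut

section NearNorming

variable {𝕜 X S : Type*} [RCLike 𝕜] [NormedAddCommGroup X] [NormedSpace 𝕜 X]
  [TopologicalSpace S] [CompactSpace S]

/-- At some point of `S`, the operator `T` attains its norm at `x` up to the relative error `η`.
The real part of `T x s`, rather than its modulus, makes this stable under averaging in `x`. -/
def NearNorming (η : ℝ) (T : X →L[𝕜] C(S, 𝕜)) (x : X) : Prop :=
  ‖x‖ ≤ 1 ∧ ∃ s, (1 - η) * ‖T‖ ≤ re (T x s)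

lemma NearNorming.smul {η : ℝ} {T : X →L[𝕜] C(S, 𝕜)} {x : X} (h : NearNorming η T x) {c : ℝ}
    (hc : 0 ≤ c) : NearNorming η (c • T) x := by
  obtain ⟨hx, s, hs⟩ := h
  refine ⟨hx, s, ?_⟩
  change (1 - η) * ‖c • T‖ ≤ re (c • T x s)
  rw [norm_smul, Real.norm_of_nonneg hc, RCLike.smul_re, mul_left_comm]
  gcongr

lemma NearNorming.one_sub_mul_norm_le {η : ℝ} {T : X →L[𝕜] C(S, 𝕜)} {x : X}
    (h : NearNorming η T x) : (1 - η) * ‖T‖ ≤ ‖T x‖ :=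
  let ⟨_, s, hs⟩ := h
  hs.trans ((re_le_norm _).trans ((T x).norm_coe_le_norm s))

lemma exists_nearNorming {T : X →L[𝕜] C(S, 𝕜)} (hT : 0 < ‖T‖) {η : ℝ} (hη : 0 < η) :
    ∃ x, NearNorming η T x := by
  obtain ⟨x, hx, hTx⟩ := T.exists_lt_apply_of_lt_opNorm (r := max 0 ((1 - η) * ‖T‖))
    (max_lt hT (by nlinarith))
  obtain ⟨s, hs⟩ : ∃ s, max 0 ((1 - η) * ‖T‖) < ‖T x s‖ := by
    by_contra! hle
    exact hTx.not_ge ((ContinuousMap.norm_le _ (le_max_left _ _)).2 hle)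
  obtain ⟨c, hc, hcs⟩ := RCLike.exists_norm_eq_mul_self (T x s)
  refine ⟨c • x, by rw [norm_smul, hc, one_mul]; exact hx.le, s, ?_⟩
  rw [T.map_smul, ContinuousMap.smul_apply, smul_eq_mul, ← hcs, RCLike.ofReal_re]
  exact (le_max_right _ _).trans hs.le

lemma normAttaining_of_tendsto {ι : Type*} {l : Filter ι} [l.NeBot] {T : ι → X →L[𝕜] C(S, 𝕜)}
    {x : ι → X} {η : ι → ℝ} {T' : X →L[𝕜] C(S, 𝕜)} {x' : X} (hT : Tendsto T l (𝓝 T'))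
    (hx : Tendsto x l (𝓝 x')) (hη : Tendsto η l (𝓝 0)) (h : ∀ i, NearNorming (η i) (T i) (x i))
    (hT' : 0 < ‖T'‖) : NormAttaining T' := by
  have hx'_le : ‖x'‖ ≤ 1 := le_of_tendsto hx.norm (.of_forall fun i => (h i).1)
  have hTx : Tendsto (fun i => T i (x i)) l (𝓝 (T' x')) :=
    ((isBoundedBilinearMap_apply (𝕜 := 𝕜)).continuous.tendsto (T', x')).comp (hT.prodMk_nhds hx)
  have hle : ‖T'‖ ≤ ‖T' x'‖ :=
    le_of_tendsto_of_tendsto (by simpa using (hη.const_sub 1).mul hT.norm) hTx.norm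
      (.of_forall fun i => (h i).one_sub_mul_norm_le)
  have hx' : ‖x'‖ = 1 := hx'_le.antisymm
    (le_of_mul_le_mul_left (by simpa using hle.trans (T'.le_opNorm x')) hT')
  exact ⟨x', hx', (T'.unit_le_opNorm x' hx'_le).antisymm hle⟩

end NearNorming

section Iteration

variable {M N : Type*} [PseudoMetricSpace M] [CompleteSpace M] [PseudoMetricSpace N]
  [CompleteSpace N]

lemma exists_seq_tendsto_of_step {P : ℕ → M → N → Prop} {A B : ℝ}
    (hstep : ∀ n a b, P n a b →
      ∃ a' b', P (n + 1) a' b' ∧ dist a a' ≤ A / 2 / 2 ^ n ∧ dist b b' ≤ B / 2 / 2 ^ n)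
    {a₀ : M} {b₀ : N} (h₀ : P 0 a₀ b₀) :
    ∃ (a : ℕ → M) (b : ℕ → N) (a' : M) (b' : N), (∀ n, P n (a n) (b n)) ∧
      Tendsto a atTop (𝓝 a') ∧ Tendsto b atTop (𝓝 b') ∧ dist a₀ a' ≤ A := by
  choose! nextA nextB hnext hdistA hdistB using hstep
  let p : ℕ → M × N := fun n => n.rec (a₀, b₀) fun k q => (nextA k q.1 q.2, nextB k q.1 q.2)
  have hp : ∀ n, P n (p n).1 (p n).2 := fun n => by
    induction n with
    | zero => exact h₀
    | succ n ih => exact hnext n _ _ ih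
  have hA : ∀ n, dist (p n).1 (p (n + 1)).1 ≤ A / 2 / 2 ^ n := fun n => hdistA n _ _ (hp n)
  have hB : ∀ n, dist (p n).2 (p (n + 1)).2 ≤ B / 2 / 2 ^ n := fun n => hdistB n _ _ (hp n)
  obtain ⟨a', ha'⟩ := cauchySeq_tendsto_of_complete (cauchySeq_of_le_geometric_two hA)
  obtain ⟨b', hb'⟩ := cauchySeq_tendsto_of_complete (cauchySeq_of_le_geometric_two hB)
  exact ⟨_, _, a', b', hp, ha', hb', dist_le_of_le_geometric_two_of_tendsto₀ hA ha'⟩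

end Iteration

section Rescaling

variable {F : Type*} [SeminormedAddCommGroup F] [NormedSpace ℝ F]

lemma norm_div_norm_smul {q : F} (hq : 0 < ‖q‖) {r : ℝ} (hr : 0 ≤ r) : ‖(r / ‖q‖) • q‖ = r := by
  rw [norm_smul, Real.norm_of_nonneg (by positivity), div_mul_cancel₀ _ hq.ne']

lemma norm_div_norm_smul_sub_le {q : F} (hq : 0 < ‖q‖) (t : F) :
    ‖(‖t‖ / ‖q‖) • q - t‖ ≤ 2 * ‖q - t‖ :=
  calc ‖(‖t‖ / ‖q‖) • q - t‖ ≤ ‖(‖t‖ / ‖q‖ - 1) • q‖ + ‖q - t‖ :=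
        (congrArg norm (by module)).trans_le (norm_add_le _ _)
    _ = |‖t‖ - ‖q‖| + ‖q - t‖ := by
        rw [norm_smul, ← abs_norm q, Real.norm_eq_abs, ← abs_mul, abs_norm, sub_mul,
          div_mul_cancel₀ _ hq.ne', one_mul]
    _ ≤ 2 * ‖q - t‖ := by
        linarith [abs_norm_sub_norm_le t q, norm_sub_rev t q]

end Rescaling

section Improvement

lemma one_sub_mul_le_of_le_one_add_mul {a b ε : ℝ} (hε : 0 ≤ ε) (ha : 0 ≤ a)
    (hab : a ≤ (1 + ε) * b) : (1 - ε) * a ≤ b := by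
  refine le_of_mul_le_mul_left ?_ (show 0 < 1 + ε by positivity)
  calc (1 + ε) * ((1 - ε) * a) = a - ε ^ 2 * a := by ring
    _ ≤ a := sub_le_self _ (by positivity)
    _ ≤ (1 + ε) * b := hab

variable {𝕜 K S H : Type*} [RCLike 𝕜] [TopologicalSpace K] [CompactSpace K]
  [TopologicalSpace S] [CompactSpace S]
  [NormedAddCommGroup H] [NormedSpace 𝕜 H] [InnerProductSpace ℝ H] [IsScalarTower ℝ 𝕜 H]

lemma exists_nearNorming_near {T : C(K, H) →L[𝕜] C(S, 𝕜)} (hT : 0 < ‖T‖) {f₀ : C(K, H)}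
    {κ δ ε : ℝ} (hκ : 0 < κ) (hκ' : κ ≤ 1 / 800) (hδ : 0 < δ) (hδ1 : δ ≤ 1) (hε : 0 < ε)
    (h₀ : NearNorming (κ * δ ^ 2) T f₀) :
    ∃ (Q : C(K, H) →L[𝕜] C(S, 𝕜)) (f : C(K, H)),
      NearNorming ε Q f ∧ ‖Q - T‖ ≤ 400 * κ * ‖T‖ ∧ ‖f - f₀‖ ≤ δ := by
  obtain ⟨hf₀, s₀, hs₀⟩ := h₀
  have hη : 0 < κ * δ ^ 2 := by positivity
  have hηκ : κ * δ ^ 2 ≤ κ := mul_le_of_le_one_right hκ.le (pow_le_one₀ hδ.le hδ1)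
  obtain ⟨R, hRT, hTR, hf₀R⟩ := exists_boost hT hf₀ hη (by linarith) hs₀
  have hR : 0 < ‖R‖ := hT.trans_le hTR
  obtain ⟨ε', hε', hε'κ, hε'ε⟩ : ∃ ε', 0 < ε' ∧ 4 * ε' ≤ κ * δ ^ 2 ∧ 6 * ε' ≤ ε :=
    ⟨min (κ * δ ^ 2 / 4) (ε / 6), by positivity,
      by linarith [min_le_left (κ * δ ^ 2 / 4) (ε / 6)],
      by linarith [min_le_right (κ * δ ^ 2 / 4) (ε / 6)]⟩
  obtain ⟨f₁, hf₁, s₁, hs₁⟩ := exists_nearNorming hR hε'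
  obtain ⟨φ, hφ, f, hsep, hf, hff₀, hff₁⟩ := exists_clip hf₀ hf₁ hδ
  have hmass : ∀ s, (1 - 2 * ε') * ‖R‖ < re (R f₁ s) →
      ‖pointFunctional R s ∘L mulOp φ‖ ≤ 8 * (8 * κ) * ‖R‖ := fun s hs => by
    have hRs := norm_pointFunctional_le R s
    have hf₀Rs := hf₀R s (by nlinarith [re_apply_le_norm_pointFunctional R s hf₁])
    -- The error `2 * (κ * δ ^ 2)` of `f₀` is `(8 * κ) * (δ / 2) ^ 2`.
    refine (norm_comp_mulOp_le_of_separated (pointFunctional R s) hφ hf₀ hf₁ (half_pos hδ)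
      (by linarith) ?_ ?_ hsep).trans (by gcongr)
    · rw [pointFunctional_apply]
      linarith
    · rw [pointFunctional_apply]
      nlinarith
  obtain ⟨Q, hQ, hQR, hQs₁⟩ := exists_cut hR hf₁ hε' (by linarith) hs₁ hφ hmass
  refine ⟨Q, f, ⟨hf, s₁, ?_⟩, ?_, hff₀⟩
  · rw [hQs₁ f hff₁]
    exact one_sub_mul_le_of_le_one_add_mul hε.le (norm_nonneg Q) (hQ.trans (by gcongr))
  · have hR2 : ‖R‖ ≤ 2 * ‖T‖ := by nlinarith [norm_le_insert' R T]
    nlinarith [norm_sub_le_norm_sub_add_norm_sub Q R T]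

lemma exists_nearNorming_near_of_norm_eq {T : C(K, H) →L[𝕜] C(S, 𝕜)} (hT : 0 < ‖T‖)
    {f₀ : C(K, H)} {κ δ ε : ℝ} (hκ : 0 < κ) (hκ' : κ ≤ 1 / 800) (hδ : 0 < δ) (hδ1 : δ ≤ 1)
    (hε : 0 < ε) (h₀ : NearNorming (κ * δ ^ 2) T f₀) :
    ∃ (T' : C(K, H) →L[𝕜] C(S, 𝕜)) (f : C(K, H)), NearNorming ε T' f ∧ ‖T'‖ = ‖T‖ ∧
      ‖T' - T‖ ≤ 800 * κ * ‖T‖ ∧ ‖f - f₀‖ ≤ δ := by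
  obtain ⟨Q, f, hQf, hQT, hff₀⟩ := exists_nearNorming_near hT hκ hκ' hδ hδ1 hε h₀
  have hQ : 0 < ‖Q‖ := by
    have := norm_sub_norm_le T Q
    rw [norm_sub_rev] at this
    nlinarith
  exact ⟨(‖T‖ / ‖Q‖) • Q, f, hQf.smul (by positivity), norm_div_norm_smul hQ (norm_nonneg T),
    (norm_div_norm_smul_sub_le hQ T).trans (by linarith), hff₀⟩

variable [CompleteSpace H]

lemma exists_normAttaining_norm_sub_le {T : C(K, H) →L[𝕜] C(S, 𝕜)} (hT : 0 < ‖T‖) {κ : ℝ}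
    (hκ : 0 < κ) (hκ' : κ ≤ 1 / 800) :
    ∃ T' : C(K, H) →L[𝕜] C(S, 𝕜), NormAttaining T' ∧ ‖T - T'‖ ≤ 1600 * κ * ‖T‖ := by
  let η : ℕ → ℝ := fun n => κ / 2 ^ n * (1 / 2 ^ n) ^ 2
  have hη : Tendsto η atTop (𝓝 0) := by
    have hpow : Tendsto (fun n : ℕ => (2 : ℝ) ^ n) atTop atTop :=
      tendsto_pow_atTop_atTop_of_one_lt one_lt_two
    simpa only [zero_mul] using (hpow.const_div_atTop κ).mul ((hpow.const_div_atTop 1).pow 2)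
  have hstep : ∀ n (U : C(K, H) →L[𝕜] C(S, 𝕜)) f, NearNorming (η n) U f ∧ ‖U‖ = ‖T‖ →
      ∃ U' f', (NearNorming (η (n + 1)) U' f' ∧ ‖U'‖ = ‖T‖) ∧
        dist U U' ≤ 1600 * κ * ‖T‖ / 2 / 2 ^ n ∧ dist f f' ≤ 2 / 2 / 2 ^ n := by
    rintro n U f ⟨hUf, hU⟩
    have hpow : (1 : ℝ) ≤ 2 ^ n := one_le_pow₀ one_le_two
    obtain ⟨U', f', hUf', hU', hUU', hff'⟩ := exists_nearNorming_near_of_norm_eq (hU ▸ hT)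
      (κ := κ / 2 ^ n) (δ := 1 / 2 ^ n) (ε := η (n + 1)) (by positivity)
      ((div_le_self hκ.le hpow).trans hκ') (by positivity) (div_le_one_of_le₀ hpow (by positivity))
      (by positivity) hUf
    refine ⟨U', f', ⟨hUf', hU'.trans hU⟩, ?_, ?_⟩
    · rw [dist_comm, dist_eq_norm]
      exact hUU'.trans_eq (by rw [hU]; ring)
    · rw [dist_comm, dist_eq_norm]
      exact hff'.trans_eq (by ring)
  obtain ⟨f₀, hf₀⟩ := exists_nearNorming hT (η := η 0) (by positivity)
  obtain ⟨U, f, T', f', hUf, hUT', hff', hTT'⟩ := exists_seq_tendsto_of_step hstep ⟨hf₀, rfl⟩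
  have hT' : ‖T'‖ = ‖T‖ :=
    tendsto_nhds_unique hUT'.norm (by simp only [(hUf _).2, tendsto_const_nhds])
  exact ⟨T', normAttaining_of_tendsto hUT' hff' hη (fun n => (hUf n).1) (hT' ▸ hT),
    (dist_eq_norm T T').symm.trans_le hTT'⟩

end Improvement

theorem mainTheorem1_general {𝕜 K S H : Type*} [RCLike 𝕜]
    [NormedAddCommGroup H] [NormedSpace 𝕜 H] [InnerProductSpace ℝ H] [IsScalarTower ℝ 𝕜 H]
    [CompleteSpace H] [Nontrivial H] [TopologicalSpace K] [CompactSpace K] [Nonempty K]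
    [TopologicalSpace S] [CompactSpace S] :
    closure {T : C(K, H) →L[𝕜] C(S, 𝕜) | NormAttaining T} = Set.univ := by
  refine Set.eq_univ_of_forall fun T => Metric.mem_closure_iff.2 fun ε hε => ?_
  rcases (norm_nonneg T).eq_or_lt with hT | hT
  · obtain ⟨f, hf⟩ := exists_norm_eq C(K, H) zero_le_one
    exact ⟨T, ⟨f, hf, (T.unit_le_opNorm f hf.le).antisymm (hT ▸ norm_nonneg _)⟩, by simpa⟩
  · obtain ⟨κ, hκ, hκε⟩ := exists_pos_mul_lt hε (1600 * ‖T‖)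
    obtain ⟨T', hT', hTT'⟩ := exists_normAttaining_norm_sub_le hT
      (lt_min hκ (by norm_num : (0 : ℝ) < 1 / 800)) (min_le_right _ _)
    refine ⟨T', hT', (dist_eq_norm T T').trans_lt (hTT'.trans_lt (hκε.trans_le' ?_))⟩
    rw [mul_right_comm]
    gcongr
    exact min_le_left _ _

theorem mainTheorem1 {K S : Type*}
    [TopologicalSpace K] [CompactSpace K] [T2Space K] [Nonempty K]
    [TopologicalSpace S] [CompactSpace S] [T2Space S] :
    closure {T : C(K, ℂ) →L[ℂ] C(S, ℂ) | NormAttaining T} = Set.univ :=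
  mainTheorem1_general
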